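/- Let $L$ be a (finite-dimensional real) Lie group and let $U$ be a compact neighbourhood of the identity in $L$. Then there is a sequence $(U_n)_{n\in\mathbb{N}}$ (with $0\in\mathbb{N}$) of compact neighbourhoods of the identity that are symmetric, i.e. $1\in U_n=U_n^{-1}$, such that $U_0$ is contained in the interior of $U$, $U_{n+1}$ is contained in the interior of $U_n$ for every $n\in\mathbb{N}$, and the following hold: (1) for each $n\in\mathbb{N}$, $U_n$ is covered by at most $17^{\dim(L)}$ left translates of $U_{n+1}$; (2) $U_{n+1}^2\subseteq U_n$ for each $n\in\mathbb{N}$, where $U_{n+1}^2=\{ab : a,b\in U_{n+1}\}$; (3) $x^{-1}U_{n+1}x\subseteq U_n$ for each $x\in U_0$ and $n\in\mathbb{N}$; (4) $[x,y]=x^{-1}y^{-1}xy\in U_n$ for all $x\in U_{n_1}$, $y\in U_{n_2}$ and all $n,n_1,n_2\in\mathbb{N}$ with $n\leq n_1+n_2$; (5) if $x,y\in U_0$ and $x^2=y^2$, then $x=y$; (6) $U_{n+4}=\{x\in U_0 : x^{17}\in U_n\}$ for each $n\in\mathbb{N}$. -/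

import Mathlib

open scoped Manifold ContDiff Pointwise Topology

/-! The sets are balls in a well-chosen chart `χ` at the identity: `V n` corresponds to the closed
ball of radius `r / q ^ n` with `q ^ 4 = 17`. If inversion reads exactly as `-1` and `x ↦ x ^ 17`
exactly as multiplication by 17, then symmetry and (6) are identities. The other items are estimates
with room to spare, because near the identity multiplication is almost addition, conjugation almost
trivial and the commutator at most bilinear in size; they need only `2.02 ≤ q ≤ 4` and `r` small.
Covering by `17 ^ dim` translates is a volume count.

The exponential map would give such a chart; here it comes from
`ContDiffAt.exists_koenigs_linearization`. The 17th power map has derivative 17 at the identity, so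
its local inverse is a contraction that can be linearised, and taking the odd part under inversion
makes inversion linear too (`exists_isTangent_map_pow`). The new chart is known only to be strictly
differentiable relative to a smooth one, with derivative `id`. This suffices for the first order
estimates; the commutator bound is proved in the smooth chart and transferred
(`LieGroup.exists_isLogChart`). -/

/-! ### Second order estimates for `C²` maps. -/

/-- A `C²` map with vanishing derivative at `0` has Lipschitz constant `O(ρ)` on the ball of
radius `ρ`. -/
lemma ContDiffAt.exists_lipschitz_bound_of_fderiv_eq_zero
    {E F : Type*} [NormedAddCommGroup E] [NormedSpace ℝ E] [NormedAddCommGroup F] [NormedSpace ℝ F]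
    {R : E → F} (hR : ContDiffAt ℝ 2 R 0) (h0 : fderiv ℝ R 0 = 0) :
    ∃ C > 0, ∃ δ > 0, ∀ ρ ≤ δ, ∀ x y : E, ‖x‖ ≤ ρ → ‖y‖ ≤ ρ →
      ‖R x - R y‖ ≤ C * ρ * ‖x - y‖ := by
  have h1 : ContDiffAt ℝ 1 (fderiv ℝ R) 0 := hR.fderiv_right (by norm_num)
  obtain ⟨K, t, ht, hK⟩ := h1.exists_lipschitzOnWith
  have hd : ∀ᶠ x in 𝓝 (0 : E), DifferentiableAt ℝ R x := by
    filter_upwards [hR.eventually (by simp)] with x hx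
    exact hx.differentiableAt (by norm_num)
  obtain ⟨δ, hδ, hb⟩ := Metric.nhds_basis_closedBall.eventually_iff.1 (hd.and ht)
  refine ⟨K + 1, by positivity, δ, hδ, fun ρ hρ x y hx hy => ?_⟩
  have hρ0 : 0 ≤ ρ := (norm_nonneg x).trans hx
  refine Convex.norm_image_sub_le_of_norm_hasFDerivWithin_le (𝕜 := ℝ) (f' := fderiv ℝ R)
    (s := Metric.closedBall 0 ρ) (fun z hz => ?_) (fun z hz => ?_) (convex_closedBall 0 ρ)
    (by simpa using hy) (by simpa using hx)
  · exact (hb (Metric.closedBall_subset_closedBall hρ hz)).1.hasFDerivAt.hasFDerivWithinAt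
  · have := hK.norm_sub_le (hb (Metric.closedBall_subset_closedBall hρ hz)).2 (mem_of_mem_nhds ht)
    rw [h0, sub_zero, sub_zero] at this
    have hz' : ‖z‖ ≤ ρ := by simpa using hz
    calc _ ≤ K * ‖z‖ := this
      _ ≤ (K + 1) * ρ := by gcongr; simp

/-- A `C²` map vanishing on both axes is bounded by a multiple of the product of the norms. -/
lemma ContDiffAt.exists_norm_le_mul_norm_of_axes
    {E F G : Type*} [NormedAddCommGroup E] [NormedSpace ℝ E] [NormedAddCommGroup F]
    [NormedSpace ℝ F] [NormedAddCommGroup G] [NormedSpace ℝ G]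
    {k : E × F → G} (hk : ContDiffAt ℝ 2 k 0)
    (h1 : ∀ᶠ a in 𝓝 (0 : E), k (a, 0) = 0) (h2 : ∀ᶠ b in 𝓝 (0 : F), k (0, b) = 0) :
    ∃ C > 0, ∀ᶠ p in 𝓝 (0 : E × F), ‖k p‖ ≤ C * ‖p.1‖ * ‖p.2‖ := by
  have hd1 : ContDiffAt ℝ 1 (fderiv ℝ k) 0 := hk.fderiv_right (by norm_num)
  obtain ⟨K, t, ht, hK⟩ := hd1.exists_lipschitzOnWith
  have hd : ∀ᶠ x in 𝓝 (0 : E × F), DifferentiableAt ℝ k x := by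
    filter_upwards [hk.eventually (by simp)] with x hx
    exact hx.differentiableAt (by norm_num)
  have h1' : ∀ᶠ p in 𝓝 (0 : E × F), k (p.1, 0) = 0 :=
    (continuous_fst.tendsto' (0 : E × F) 0 rfl).eventually h1
  have h2' : ∀ᶠ p in 𝓝 (0 : E × F), k (0, p.2) = 0 :=
    (continuous_snd.tendsto' (0 : E × F) 0 rfl).eventually h2
  obtain ⟨δ, hδ, hb⟩ := Metric.nhds_basis_closedBall.eventually_iff.1
    ((hd.and ht).and (h1'.and h2'))
  refine ⟨K + 1, by positivity, ?_⟩
  filter_upwards [Metric.closedBall_mem_nhds (0 : E × F) hδ] with p hp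
  obtain ⟨a, b⟩ := p
  have hab : ‖a‖ ≤ δ ∧ ‖b‖ ≤ δ := by simpa [Prod.norm_def] using hp
  have hmem : ∀ a' b', ‖a'‖ ≤ δ → ‖b'‖ ≤ δ → ((a', b') : E × F) ∈ Metric.closedBall 0 δ := by
    intro a' b' h h'
    simpa [Prod.norm_def] using ⟨h, h'⟩
  -- Since `k` vanishes on the axes, `g b - g 0 = k (a, b)`. The derivative of `g` is a difference
  -- of derivatives of `k` at points `‖a‖` apart, hence at most `K * ‖a‖`, and the mean value
  -- inequality supplies the factor `‖b‖`.
  let g : F → G := fun y => k (a, y) - k (0, y)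
  let g' : F → F →L[ℝ] G := fun y =>
    (fderiv ℝ k (a, y) - fderiv ℝ k (0, y)).comp (ContinuousLinearMap.inr ℝ E F)
  have key := Convex.norm_image_sub_le_of_norm_hasFDerivWithin_le (𝕜 := ℝ) (f := g) (f' := g')
    (s := Metric.closedBall 0 δ) (C := K * ‖a‖) (x := 0) (y := b) ?_ ?_ (convex_closedBall 0 δ)
    (by simpa using hδ.le) (by simpa using hab.2)
  · have e1 : k (a, 0) = 0 := (hb hp).2.1
    have e2 : k (0, b) = 0 := (hb hp).2.2
    have e3 : k (0, 0) = 0 := (hb (hmem 0 0 (by simpa using hδ.le) (by simpa using hδ.le))).2.1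
    simp only [g, e1, e2, e3, sub_zero] at key
    calc _ ≤ K * ‖a‖ * ‖b‖ := key
      _ ≤ _ := by dsimp only; gcongr; simp
  · intro y hy
    have hy' : ‖y‖ ≤ δ := by simpa using hy
    have d1 := (hb (hmem a y hab.1 hy')).1.1.hasFDerivAt.comp y (hasFDerivAt_prodMk_right a y)
    have d2 := (hb (hmem 0 y (by simpa using hδ.le) hy')).1.1.hasFDerivAt.comp y
      (hasFDerivAt_prodMk_right 0 y)
    exact ((d1.sub d2).congr_fderiv (by simp [g', ContinuousLinearMap.sub_comp])).hasFDerivWithinAt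
  · intro y hy
    have hy' : ‖y‖ ≤ δ := by simpa using hy
    have := hK.norm_sub_le (hb (hmem a y hab.1 hy')).1.2
      (hb (hmem 0 y (by simpa using hδ.le) hy')).1.2
    calc ‖g' y‖ ≤ ‖fderiv ℝ k (a, y) - fderiv ℝ k (0, y)‖ * ‖ContinuousLinearMap.inr ℝ E F‖ :=
          ContinuousLinearMap.opNorm_comp_le _ _
      _ ≤ (K * ‖((a, y) : E × F) - (0, y)‖) * 1 := by
          gcongr
          exact ContinuousLinearMap.norm_inr_le_one ℝ E F
      _ = K * ‖a‖ := by simp [Prod.norm_def]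

/-! ### Koenigs linearisation. -/

/-- Koenigs linearisation: a `C²` contraction with derivative `k • id` at its fixed point `0` is
linearised by a map which is strictly differentiable with derivative `id`. -/
theorem ContDiffAt.exists_koenigs_linearization
    {E : Type*} [NormedAddCommGroup E] [NormedSpace ℝ E] [CompleteSpace E]
    {T : E → E} {k : ℝ} (hk0 : 0 < k) (hk1 : k < 1) (hT : ContDiffAt ℝ 2 T 0) (hT0 : T 0 = 0)
    (hT' : HasFDerivAt T (k • ContinuousLinearMap.id ℝ E) 0) :
    ∃ ψ : E → E, ψ 0 = 0 ∧ HasStrictFDerivAt ψ (ContinuousLinearMap.id ℝ E) 0 ∧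
      ∀ᶠ x in 𝓝 0, ψ (T x) = k • ψ x := by
  obtain ⟨R, hRdef⟩ : ∃ R : E → E, ∀ x, R x = T x - k • x := ⟨_, fun _ => rfl⟩
  have hR0 : R 0 = 0 := by simp [hRdef, hT0]
  have hRe : R = fun x => T x - k • x := funext hRdef
  have hR2 : ContDiffAt ℝ 2 R 0 := by
    rw [hRe]; exact hT.sub (contDiffAt_id.const_smul k)
  have hR' : fderiv ℝ R 0 = 0 := by
    rw [hRe]
    have := (hT'.sub ((hasFDerivAt_id (𝕜 := ℝ) (0 : E)).const_smul k)).fderiv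
    rw [sub_self] at this
    exact this
  obtain ⟨C, hC, δ₀, hδ₀, hLip⟩ := hR2.exists_lipschitz_bound_of_fderiv_eq_zero hR'
  -- `θ` will be a Lipschitz constant of `T` near 0, so it must exceed `k`; `θ ^ 2 < k` makes the
  -- series below converge.
  obtain ⟨θ, hkθ, hθk⟩ : ∃ θ, k < θ ∧ θ < √k := exists_between (Real.lt_sqrt_of_sq_lt (by nlinarith))
  have hθ0 : 0 < θ := hk0.trans hkθ
  have hθ2 : θ ^ 2 < k := (Real.lt_sqrt hθ0.le).1 hθk
  have hθ1 : θ < 1 := by nlinarith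
  obtain ⟨δ, hδ, hδδ₀, hδC⟩ : ∃ δ > 0, δ ≤ δ₀ ∧ k + C * δ ≤ θ := by
    refine ⟨min δ₀ ((θ - k) / C), lt_min hδ₀ (div_pos (by linarith) hC), min_le_left _ _, ?_⟩
    have : C * min δ₀ ((θ - k) / C) ≤ C * ((θ - k) / C) := by gcongr; exact min_le_right _ _
    rw [mul_div_cancel₀ _ hC.ne'] at this
    linarith
  have hTLip : ∀ x y, ‖x‖ ≤ δ → ‖y‖ ≤ δ → ‖T x - T y‖ ≤ θ * ‖x - y‖ := by
    intro x y hx hy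
    have h1 := hLip δ hδδ₀ x y hx hy
    have h2 : T x - T y = k • (x - y) + (R x - R y) := by rw [hRdef, hRdef, smul_sub]; abel
    calc ‖T x - T y‖ ≤ ‖k • (x - y)‖ + ‖R x - R y‖ := by rw [h2]; exact norm_add_le _ _
      _ ≤ k * ‖x - y‖ + C * δ * ‖x - y‖ := by
          rw [norm_smul, Real.norm_of_nonneg hk0.le]; gcongr
      _ = (k + C * δ) * ‖x - y‖ := by ring
      _ ≤ _ := by gcongr
  have hTn : ∀ ρ ≤ δ, ∀ n x, ‖x‖ ≤ ρ → ‖T^[n] x‖ ≤ θ ^ n * ρ := by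
    intro ρ hρ n
    induction n with
    | zero => intro x hx; simpa using hx
    | succ n ih =>
      intro x hx
      have hρ0 : 0 ≤ ρ := (norm_nonneg x).trans hx
      rw [Function.iterate_succ_apply']
      have hle : ‖T^[n] x‖ ≤ δ := (ih x hx).trans
        ((mul_le_of_le_one_left hρ0 (pow_le_one₀ hθ0.le hθ1.le)).trans hρ)
      have := hTLip _ 0 hle (by simpa using hδ.le)
      rw [hT0, sub_zero, sub_zero] at this
      calc _ ≤ θ * ‖T^[n] x‖ := this
        _ ≤ θ * (θ ^ n * ρ) := by gcongr; exact ih x hx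
        _ = _ := by ring
  have hTnLip : ∀ n x y, ‖x‖ ≤ δ → ‖y‖ ≤ δ → ‖T^[n] x - T^[n] y‖ ≤ θ ^ n * ‖x - y‖ := by
    intro n
    induction n with
    | zero => intro x y _ _; simp
    | succ n ih =>
      intro x y hx hy
      rw [Function.iterate_succ_apply', Function.iterate_succ_apply']
      have hle : ∀ z, ‖z‖ ≤ δ → ‖T^[n] z‖ ≤ δ := fun z hz => (hTn δ le_rfl n z hz).trans
        (mul_le_of_le_one_left hδ.le (pow_le_one₀ hθ0.le hθ1.le))
      calc _ ≤ θ * ‖T^[n] x - T^[n] y‖ := hTLip _ _ (hle x hx) (hle y hy)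
        _ ≤ θ * (θ ^ n * ‖x - y‖) := by gcongr; exact ih x y hx hy
        _ = _ := by ring
  -- These are the increments of `k⁻¹ ^ n • T^[n] x`, whose limit is the linearising map.
  obtain ⟨u, hu⟩ : ∃ u : E → ℕ → E, ∀ x n, u x n = (k⁻¹ ^ (n + 1)) • R (T^[n] x) :=
    ⟨_, fun _ _ => rfl⟩
  have hubound : ∀ ρ ≤ δ, ∀ x y, ‖x‖ ≤ ρ → ‖y‖ ≤ ρ → ∀ n,
      ‖u x n - u y n‖ ≤ (k⁻¹ * C * ρ * ‖x - y‖) * (θ ^ 2 / k) ^ n := by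
    intro ρ hρ x y hx hy n
    have hρ0 : 0 ≤ ρ := (norm_nonneg x).trans hx
    have hθn : θ ^ n * ρ ≤ ρ := mul_le_of_le_one_left hρ0 (pow_le_one₀ hθ0.le hθ1.le)
    -- One factor `θ ^ n` comes from the Lipschitz constant of `R` on the shrunken ball, the other
    -- from the contraction of distances; together they beat `k⁻¹ ^ n`.
    have h1 := hLip (θ ^ n * ρ) (hθn.trans (hρ.trans hδδ₀)) _ _ (hTn ρ hρ n x hx) (hTn ρ hρ n y hy)
    have h2 := hTnLip n x y (hx.trans hρ) (hy.trans hρ)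
    rw [hu, hu, ← smul_sub, norm_smul, Real.norm_of_nonneg (by positivity)]
    calc _ ≤ k⁻¹ ^ (n + 1) * (C * (θ ^ n * ρ) * (θ ^ n * ‖x - y‖)) := by
          gcongr; exact h1.trans (by gcongr)
      _ = _ := by
        rw [div_pow, pow_succ, div_eq_mul_inv, inv_pow]; ring
  have hu0 : ∀ n, u 0 n = 0 := by
    intro n
    have : T^[n] 0 = 0 := Function.iterate_fixed hT0 n
    rw [hu, this, hR0, smul_zero]
  have hr0 : 0 ≤ θ ^ 2 / k := by positivity
  have hr1 : θ ^ 2 / k < 1 := (div_lt_one hk0).2 hθ2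
  have hsum : ∀ x, ‖x‖ ≤ δ → Summable (u x) := by
    intro x hx
    refine Summable.of_norm_bounded ((summable_geometric_of_lt_one hr0 hr1).mul_left
      (k⁻¹ * C * δ * ‖x - 0‖)) fun n => ?_
    have := hubound δ le_rfl x 0 hx (by simpa using hδ.le) n
    rwa [hu0, sub_zero] at this
  refine ⟨fun x => x + ∑' n, u x n, by simp [hu0], ?_, ?_⟩
  · have hS : ∀ ρ ≤ δ, ∀ x y, ‖x‖ ≤ ρ → ‖y‖ ≤ ρ →
        ‖∑' n, u x n - ∑' n, u y n‖ ≤ (k⁻¹ * C * ρ * ‖x - y‖) * (1 - θ ^ 2 / k)⁻¹ := by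
      intro ρ hρ x y hx hy
      rw [← (hsum x (hx.trans hρ)).tsum_sub (hsum y (hy.trans hρ))]
      exact tsum_of_norm_bounded ((hasSum_geometric_of_lt_one hr0 hr1).mul_left _)
        (hubound ρ hρ x y hx hy)
    -- The Lipschitz constant of the sum on the ball of radius `ρ` is `O(ρ)`, which is strict
    -- differentiability with derivative 0.
    have hS' : HasStrictFDerivAt (fun x => ∑' n, u x n) (0 : E →L[ℝ] E) 0 := by
      refine HasStrictFDerivAt.of_isLittleO (Asymptotics.isLittleO_iff.2 fun c hc => ?_)
      have hM : 0 < k⁻¹ * C * (1 - θ ^ 2 / k)⁻¹ := by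
        have : 0 < 1 - θ ^ 2 / k := by linarith
        positivity
      have hρ : 0 < min δ (c / (k⁻¹ * C * (1 - θ ^ 2 / k)⁻¹)) := lt_min hδ (by positivity)
      filter_upwards [Metric.closedBall_mem_nhds ((0, 0) : E × E) hρ] with p hp
      have hp' : ‖p.1‖ ≤ min δ (c / (k⁻¹ * C * (1 - θ ^ 2 / k)⁻¹)) ∧
          ‖p.2‖ ≤ min δ (c / (k⁻¹ * C * (1 - θ ^ 2 / k)⁻¹)) := by
        rw [Prod.mk_zero_zero, mem_closedBall_zero_iff, Prod.norm_def] at hp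
        exact max_le_iff.1 hp
      have := hS _ (min_le_left _ _) p.1 p.2 hp'.1 hp'.2
      rw [zero_apply, sub_zero]
      refine this.trans ?_
      have h3 := (le_div_iff₀ hM).1 (min_le_right δ (c / (k⁻¹ * C * (1 - θ ^ 2 / k)⁻¹)))
      calc _ = min δ (c / (k⁻¹ * C * (1 - θ ^ 2 / k)⁻¹)) * (k⁻¹ * C * (1 - θ ^ 2 / k)⁻¹)
            * ‖p.1 - p.2‖ := by ring
        _ ≤ _ := by gcongr
    have := (hasStrictFDerivAt_id (𝕜 := ℝ) (0 : E)).add hS'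
    rw [add_zero] at this
    exact this
  · filter_upwards [Metric.closedBall_mem_nhds (0 : E) hδ] with x hx
    have hx' : ‖x‖ ≤ δ := by simpa using hx
    have hshift : ∀ n, u x (n + 1) = k⁻¹ • u (T x) n := by
      intro n
      rw [hu, hu, Function.iterate_succ_apply, smul_smul, pow_succ' _ (n + 1)]
    have h0 : u x 0 = k⁻¹ • T x - x := by
      rw [hu, hRdef]
      simp [smul_sub, smul_smul, inv_mul_cancel₀ hk0.ne']
    rw [(hsum x hx').tsum_eq_zero_add, h0]
    simp_rw [hshift]
    rw [tsum_const_smul'', smul_add, smul_add, smul_sub, smul_smul, smul_smul,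
      mul_inv_cancel₀ hk0.ne', one_smul, one_smul]
    abel

/-! ### Covering balls by volume comparison. -/

/-- An `ε R`-separated finite subset of the ball of radius `R` has at most `(1 + 2 / ε) ^ dim`
elements. -/
lemma Finset.card_le_of_separated_of_norm_le
    {E : Type*} [NormedAddCommGroup E] [NormedSpace ℝ E] [FiniteDimensional ℝ E]
    {R ε : ℝ} (hR : 0 < R) (hε : 0 < ε) (s : Finset E) (hs : ∀ c ∈ s, ‖c‖ ≤ R)
    (h : ∀ c ∈ s, ∀ d ∈ s, c ≠ d → ε * R ≤ ‖c - d‖) :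
    (s.card : ℝ) ≤ (1 + 2 / ε) ^ Module.finrank ℝ E := by
  borelize E
  let μ : MeasureTheory.Measure E := MeasureTheory.Measure.addHaar
  have hδ : 0 < ε * R / 2 := by positivity
  have hρ : 0 < R + ε * R / 2 := by positivity
  have hD : Set.Pairwise (s : Set E)
      (Function.onFun Disjoint fun c => Metric.ball (c : E) (ε * R / 2)) := by
    intro c hc d hd hcd
    apply Metric.ball_disjoint_ball
    rw [dist_eq_norm, add_halves]
    exact h c hc d hd hcd
  have hsub : (⋃ c ∈ s, Metric.ball (c : E) (ε * R / 2)) ⊆ Metric.ball 0 (R + ε * R / 2) := by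
    refine Set.iUnion₂_subset fun x hx => Metric.ball_subset_ball' ?_
    rw [dist_zero_right]
    linarith [hs x hx]
  have h1 : (s.card : ENNReal) * ENNReal.ofReal ((ε * R / 2) ^ Module.finrank ℝ E)
        * μ (Metric.ball 0 1)
      ≤ ENNReal.ofReal ((R + ε * R / 2) ^ Module.finrank ℝ E) * μ (Metric.ball 0 1) :=
    calc _ = μ (⋃ c ∈ s, Metric.ball (c : E) (ε * R / 2)) := by
          rw [MeasureTheory.measure_biUnion_finset hD fun c _ => measurableSet_ball]
          simp only [μ.addHaar_ball_of_pos _ hδ, Finset.sum_const, nsmul_eq_mul, mul_assoc]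
      _ ≤ μ (Metric.ball 0 (R + ε * R / 2)) := MeasureTheory.measure_mono hsub
      _ = _ := by rw [μ.addHaar_ball_of_pos _ hρ]
  have h2 := (ENNReal.mul_le_mul_iff_left (Metric.measure_ball_pos μ _ zero_lt_one).ne'
    MeasureTheory.measure_ball_lt_top.ne).1 h1
  have h3 := ENNReal.toReal_le_of_le_ofReal (by positivity) h2
  rw [ENNReal.toReal_mul, ENNReal.toReal_natCast, ENNReal.toReal_ofReal (by positivity),
    ← le_div_iff₀ (by positivity), ← div_pow] at h3
  convert! h3 using 2
  field_simp
  ring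

/-- The ball of radius `R` is covered by `17 ^ dim` balls of radius `R / 8` centred in it. -/
lemma exists_finset_card_le_cover_closedBall
    (E : Type*) [NormedAddCommGroup E] [NormedSpace ℝ E] [FiniteDimensional ℝ E]
    {R : ℝ} (hR : 0 < R) :
    ∃ s : Finset E, s.card ≤ 17 ^ Module.finrank ℝ E ∧ (∀ z ∈ s, ‖z‖ ≤ R) ∧
      ∀ x : E, ‖x‖ ≤ R → ∃ z ∈ s, ‖x - z‖ ≤ R / 8 := by
  classical
  let P : Finset E → Prop := fun s => (∀ z ∈ s, ‖z‖ ≤ R) ∧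
    ∀ c ∈ s, ∀ d ∈ s, c ≠ d → 1 / 8 * R ≤ ‖c - d‖
  -- Separation `R / 8` gives `1 + 2 / (1 / 8) = 17`. A separated set of maximal cardinality is then
  -- an `R / 8`-net.
  have hcard : ∀ s, P s → s.card ≤ 17 ^ Module.finrank ℝ E := by
    intro s hs
    have := s.card_le_of_separated_of_norm_le hR (by norm_num) hs.1 hs.2
    norm_num at this
    exact_mod_cast this
  obtain ⟨n, ⟨s, hs, rfl⟩, hmax⟩ : ∃ n, (∃ s, P s ∧ s.card = n) ∧
      ∀ m, (∃ s, P s ∧ s.card = m) → m ≤ n := by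
    have hb : BddAbove {n | ∃ s, P s ∧ s.card = n} :=
      ⟨17 ^ Module.finrank ℝ E, by rintro _ ⟨s, hs, rfl⟩; exact hcard s hs⟩
    have hne : {n | ∃ s, P s ∧ s.card = n}.Nonempty := ⟨0, ∅, by simp [P], rfl⟩
    exact ⟨_, Nat.sSup_mem hne hb, fun m hm => le_csSup hb hm⟩
  refine ⟨s, hcard s hs, hs.1, fun x hx => ?_⟩
  by_contra! hcon
  have hxs : x ∉ s := fun hxs => by
    have := hcon x hxs
    rw [sub_self, norm_zero] at this
    linarith
  have hP : P (insert x s) := by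
    refine ⟨fun z hz => ?_, fun c hc d hd hcd => ?_⟩
    · rcases Finset.mem_insert.1 hz with rfl | hz
      exacts [hx, hs.1 z hz]
    · rcases Finset.mem_insert.1 hc with rfl | hc' <;> rcases Finset.mem_insert.1 hd with rfl | hd'
      · exact absurd rfl hcd
      · linarith [hcon d hd']
      · rw [norm_sub_rev]; linarith [hcon c hc']
      · exact hs.2 c hc' d hd' hcd
  have := hmax _ ⟨_, hP, rfl⟩
  rw [Finset.card_insert_of_notMem hxs] at this
  omega

/-! ### Charts centred at the identity. -/

section Centred

variable {L E : Type*} [TopologicalSpace L] [One L] [NormedAddCommGroup E]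

/-- A local homeomorphism from a pointed space to a normed space, sending `1` to `0`. -/
structure OpenPartialHomeomorph.IsCentred (χ : OpenPartialHomeomorph L E) : Prop where
  mem_source : (1 : L) ∈ χ.source
  map_one : χ 1 = 0

namespace OpenPartialHomeomorph.IsCentred

variable {χ : OpenPartialHomeomorph L E} (hχ : χ.IsCentred)
include hχ

lemma zero_mem_target : (0 : E) ∈ χ.target := hχ.map_one ▸ χ.map_source hχ.mem_source

lemma symm_zero : χ.symm 0 = 1 := by rw [← hχ.map_one, χ.left_inv hχ.mem_source]

lemma tendsto : Filter.Tendsto χ (𝓝 1) (𝓝 0) := by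
  simpa [ContinuousAt, hχ.map_one] using χ.continuousAt hχ.mem_source

lemma tendsto_symm : Filter.Tendsto χ.symm (𝓝 0) (𝓝 1) := by
  simpa [ContinuousAt, hχ.symm_zero] using χ.symm.continuousAt (x := 0) hχ.zero_mem_target

lemma eventually_mem_source : ∀ᶠ x in 𝓝 1, x ∈ χ.source :=
  χ.open_source.mem_nhds hχ.mem_source

lemma eventually_mem_target : ∀ᶠ a in 𝓝 0, a ∈ χ.target :=
  χ.open_target.mem_nhds hχ.zero_mem_target

end OpenPartialHomeomorph.IsCentred

end Centred

/-! ### Smooth maps read in a centred chart. -/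

section LieGroup

variable {E : Type*} [NormedAddCommGroup E] [NormedSpace ℝ E]
  {H : Type*} [TopologicalSpace H] {I : ModelWithCorners ℝ E H}
  {L : Type*} [TopologicalSpace L] [ChartedSpace H L]

/-- The preferred chart at `1`, translated so as to send `1` to `0`. -/
lemma exists_centred_smooth_chart [I.Boundaryless] [One L] [IsManifold I ∞ L] :
    ∃ φ : OpenPartialHomeomorph L E, φ.IsCentred ∧ ContMDiffAt I 𝓘(ℝ, E) ∞ φ 1 ∧
      ContMDiffAt 𝓘(ℝ, E) I ∞ φ.symm 0 := by
  let φ₀ : OpenPartialHomeomorph L E :=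
    { extChartAt I (1 : L) with
      open_source := isOpen_extChartAt_source 1
      open_target := isOpen_extChartAt_target 1
      continuousOn_toFun := continuousOn_extChartAt 1
      continuousOn_invFun := continuousOn_extChartAt_symm 1 }
  let τ : E ≃ₜ E := Homeomorph.addRight (-(extChartAt I (1 : L) 1))
  refine ⟨φ₀.transHomeomorph τ, ⟨mem_extChartAt_source 1, ?_⟩, ?_, ?_⟩
  · change extChartAt I (1 : L) 1 + -(extChartAt I (1 : L) 1) = 0
    exact add_neg_cancel _
  · have h1 : ContMDiffAt 𝓘(ℝ, E) 𝓘(ℝ, E) ∞ τ (extChartAt I (1 : L) 1) :=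
      (contDiff_id.add contDiff_const).contDiffAt.contMDiffAt
    exact h1.comp (1 : L) contMDiffAt_extChartAt
  · have h1 : ContMDiffAt 𝓘(ℝ, E) 𝓘(ℝ, E) ∞ τ.symm 0 :=
      (contDiff_id.add contDiff_const : ContDiff ℝ ∞ fun x : E =>
        x + - -(extChartAt I (1 : L) 1)).contDiffAt.contMDiffAt
    have h2 : ContMDiffAt 𝓘(ℝ, E) I ∞ (extChartAt I (1 : L)).symm (extChartAt I (1 : L) 1) :=
      (contMDiffOn_extChartAt_symm (1 : L)).contMDiffAt (extChartAt_target_mem_nhds 1)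
    have e : τ.symm 0 = extChartAt I (1 : L) 1 := by
      change 0 + - -(extChartAt I (1 : L) 1) = _
      simp
    rw [← e] at h2
    exact ContMDiffAt.comp (0 : E) (f := τ.symm) (g := (extChartAt I (1 : L)).symm) h2 h1

variable [One L]

/-- A smooth map fixing `1`, read in a centred smooth chart. -/
lemma ContMDiff.contDiffAt_centred {φ : OpenPartialHomeomorph L E} (hφ : φ.IsCentred)
    (h1 : ContMDiffAt I 𝓘(ℝ, E) ∞ φ 1) (h2 : ContMDiffAt 𝓘(ℝ, E) I ∞ φ.symm 0)
    {g : L → L} (hg : ContMDiff I I ∞ g) (hg1 : g 1 = 1) :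
    ContDiffAt ℝ ∞ (fun a => φ (g (φ.symm a))) 0 := by
  rw [← contMDiffAt_iff_contDiffAt]
  have h3 : ContMDiffAt 𝓘(ℝ, E) I ∞ (fun a => g (φ.symm a)) 0 := hg.contMDiffAt.comp _ h2
  exact ContMDiffAt.comp (0 : E) (g := φ) (by rw [hφ.symm_zero, hg1]; exact h1) h3

/-- A smooth binary operation fixing `1`, read in a centred smooth chart. -/
lemma ContMDiff.contDiffAt_centred_prod {φ : OpenPartialHomeomorph L E} (hφ : φ.IsCentred)
    (h1 : ContMDiffAt I 𝓘(ℝ, E) ∞ φ 1) (h2 : ContMDiffAt 𝓘(ℝ, E) I ∞ φ.symm 0)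
    {G : L × L → L} (hG : ContMDiff (I.prod I) I ∞ G) (hG1 : G (1, 1) = 1) :
    ContDiffAt ℝ ∞ (fun p : E × E => φ (G (φ.symm p.1, φ.symm p.2))) 0 := by
  rw [← contMDiffAt_iff_contDiffAt]
  have hf : ContMDiffAt 𝓘(ℝ, E × E) I ∞ (fun p : E × E => φ.symm p.1) 0 :=
    ContMDiffAt.comp (0 : E × E) (g := φ.symm) h2 contDiff_fst.contDiffAt.contMDiffAt
  have hs : ContMDiffAt 𝓘(ℝ, E × E) I ∞ (fun p : E × E => φ.symm p.2) 0 :=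
    ContMDiffAt.comp (0 : E × E) (g := φ.symm) h2 contDiff_snd.contDiffAt.contMDiffAt
  have h3 : ContMDiffAt 𝓘(ℝ, E × E) I ∞ (fun p : E × E => G (φ.symm p.1, φ.symm p.2)) 0 :=
    ContMDiffAt.comp (0 : E × E) (g := G) hG.contMDiffAt (hf.prodMk hs)
  refine ContMDiffAt.comp (0 : E × E) (g := φ) ?_ h3
  simp only [Prod.fst_zero, Prod.snd_zero]
  rw [hφ.symm_zero, hG1]; exact h1

end LieGroup

/-! ### Strict differentiability under change of tangent charts. -/

section Strict

variable {E : Type*} [NormedAddCommGroup E] [NormedSpace ℝ E]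
  {L : Type*} [TopologicalSpace L] [One L]

/-- Two centred charts whose transition map is strictly differentiable with derivative `id`. -/
structure OpenPartialHomeomorph.IsTangent (φ χ : OpenPartialHomeomorph L E) : Prop where
  transition : HasStrictFDerivAt (fun a => χ (φ.symm a)) (ContinuousLinearMap.id ℝ E) 0
  transition_symm : HasStrictFDerivAt (fun a => φ (χ.symm a)) (ContinuousLinearMap.id ℝ E) 0

/-- Strict differentiability of a binary operation passes to a tangent chart. -/
lemma OpenPartialHomeomorph.IsTangent.hasStrictFDerivAt {φ χ : OpenPartialHomeomorph L E}
    (hφ : φ.IsCentred) (hχ : χ.IsCentred) (h : φ.IsTangent χ) {G : L × L → L}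
    (hGc : ContinuousAt G (1, 1)) (hG1 : G (1, 1) = 1) {D : E × E →L[ℝ] E}
    (hG : HasStrictFDerivAt (fun p : E × E => φ (G (φ.symm p.1, φ.symm p.2))) D 0) :
    HasStrictFDerivAt (fun p : E × E => χ (G (χ.symm p.1, χ.symm p.2))) D 0 := by
  have hT : Filter.Tendsto (fun p : E × E => (χ.symm p.1, χ.symm p.2)) (𝓝 0) (𝓝 (1, 1)) :=
    (hχ.tendsto_symm.comp (continuous_fst.tendsto' (0 : E × E) 0 rfl)).prodMk_nhds
      (hχ.tendsto_symm.comp (continuous_snd.tendsto' (0 : E × E) 0 rfl))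
  have hGt : Filter.Tendsto G (𝓝 (1, 1)) (𝓝 1) := by simpa [ContinuousAt, hG1] using hGc
  have e0 : φ (χ.symm 0) = 0 := by rw [hχ.symm_zero, hφ.map_one]
  have s1 : HasStrictFDerivAt (fun p : E × E => φ (χ.symm p.1))
      (ContinuousLinearMap.fst ℝ E E) 0 := by
    have := HasStrictFDerivAt.comp (0 : E × E) (f := Prod.fst) (g := fun a => φ (χ.symm a))
      h.transition_symm hasStrictFDerivAt_fst
    rwa [ContinuousLinearMap.id_comp] at this
  have s2 : HasStrictFDerivAt (fun p : E × E => φ (χ.symm p.2))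
      (ContinuousLinearMap.snd ℝ E E) 0 := by
    have := HasStrictFDerivAt.comp (0 : E × E) (f := Prod.snd) (g := fun a => φ (χ.symm a))
      h.transition_symm hasStrictFDerivAt_snd
    rwa [ContinuousLinearMap.id_comp] at this
  have s4 : HasStrictFDerivAt (fun p : E × E => φ (G (φ.symm (φ (χ.symm p.1)),
      φ.symm (φ (χ.symm p.2))))) D 0 := by
    have := HasStrictFDerivAt.comp (0 : E × E) (f := fun p : E × E => (φ (χ.symm p.1), φ (χ.symm p.2)))
      (g := fun p : E × E => φ (G (φ.symm p.1, φ.symm p.2))) (g' := D)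
      (by simp only [Prod.fst_zero, Prod.snd_zero, e0]; exact hG) (s1.prodMk s2)
    simpa [ContinuousLinearMap.fst_prod_snd] using this
  have s5 : HasStrictFDerivAt (fun p : E × E => χ (φ.symm (φ (G (φ.symm (φ (χ.symm p.1)),
      φ.symm (φ (χ.symm p.2))))))) D 0 := by
    have := HasStrictFDerivAt.comp (0 : E × E) (g := fun a => χ (φ.symm a))
      (g' := ContinuousLinearMap.id ℝ E)
      (by simpa [e0, hφ.symm_zero, hG1, hφ.map_one] using h.transition) s4
    simpa using this
  refine s5.congr_of_eventuallyEq ?_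
  have v1 : ∀ᶠ p : L × L in 𝓝 (1, 1), p.1 ∈ φ.source ∧ p.2 ∈ φ.source :=
    ((continuous_fst.tendsto' ((1, 1) : L × L) 1 rfl).eventually hφ.eventually_mem_source).and
      ((continuous_snd.tendsto' ((1, 1) : L × L) 1 rfl).eventually hφ.eventually_mem_source)
  filter_upwards [hT.eventually v1, hT.eventually (hGt.eventually hφ.eventually_mem_source)]
    with p hp hG
  rw [φ.left_inv hp.1, φ.left_inv hp.2, φ.left_inv hG]

/-- Strict differentiability in a chart, expressed as an estimate on the group. -/
lemma OpenPartialHomeomorph.IsCentred.eventually_norm_sub_le {χ : OpenPartialHomeomorph L E}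
    (hχ : χ.IsCentred) {G : L × L → L} {D : E × E →L[ℝ] E}
    (hG : HasStrictFDerivAt (fun p : E × E => χ (G (χ.symm p.1, χ.symm p.2))) D 0)
    {ε : ℝ} (hε : 0 < ε) :
    ∀ᶠ q : (L × L) × (L × L) in 𝓝 ((1, 1), (1, 1)),
      ‖χ (G q.1) - χ (G q.2) - D (χ q.1.1 - χ q.2.1, χ q.1.2 - χ q.2.2)‖ ≤
        ε * max ‖χ q.1.1 - χ q.2.1‖ ‖χ q.1.2 - χ q.2.2‖ := by
  have h := Asymptotics.isLittleO_iff.1 hG.isLittleO hε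
  have t1 : Filter.Tendsto (fun p : L × L => (χ p.1, χ p.2)) (𝓝 (1, 1)) (𝓝 ((0 : E), (0 : E))) :=
    (hχ.tendsto.comp (continuous_fst.tendsto' ((1, 1) : L × L) 1 rfl)).prodMk_nhds
      (hχ.tendsto.comp (continuous_snd.tendsto' ((1, 1) : L × L) 1 rfl))
  have t2 : Filter.Tendsto (fun q : (L × L) × (L × L) => ((χ q.1.1, χ q.1.2), (χ q.2.1, χ q.2.2)))
      (𝓝 ((1, 1), (1, 1))) (𝓝 ((0 : E × E), (0 : E × E))) :=
    (t1.comp (continuous_fst.tendsto' (((1, 1), (1, 1)) : (L × L) × (L × L)) _ rfl)).prodMk_nhds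
      (t1.comp (continuous_snd.tendsto' (((1, 1), (1, 1)) : (L × L) × (L × L)) _ rfl))
  have v1 : ∀ᶠ p : L × L in 𝓝 (1, 1), p.1 ∈ χ.source ∧ p.2 ∈ χ.source :=
    ((continuous_fst.tendsto' ((1, 1) : L × L) 1 rfl).eventually hχ.eventually_mem_source).and
      ((continuous_snd.tendsto' ((1, 1) : L × L) 1 rfl).eventually hχ.eventually_mem_source)
  filter_upwards [t2.eventually h, (continuous_fst.tendsto'
    (((1, 1), (1, 1)) : (L × L) × (L × L)) _ rfl).eventually v1, (continuous_snd.tendsto'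
    (((1, 1), (1, 1)) : (L × L) × (L × L)) _ rfl).eventually v1] with q hq h1 h2
  simpa [χ.left_inv h1.1, χ.left_inv h1.2, χ.left_inv h2.1, χ.left_inv h2.2, Prod.norm_def] using hq

end Strict

/-! ### Derivatives at the origin from values on the axes and the diagonal. -/

section Derivatives

variable {E : Type*} [NormedAddCommGroup E] [NormedSpace ℝ E]

lemma HasStrictFDerivAt.comp_inl_zero {W : E × E → E} {D : E × E →L[ℝ] E}
    (hW : HasStrictFDerivAt W D 0) :
    HasStrictFDerivAt (fun a => W (a, 0)) (D.comp (ContinuousLinearMap.inl ℝ E E)) 0 :=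
  HasStrictFDerivAt.comp (0 : E) (f := fun a : E => (a, (0 : E))) (g := W) hW
    (ContinuousLinearMap.inl ℝ E E).hasStrictFDerivAt

lemma HasStrictFDerivAt.comp_inr_zero {W : E × E → E} {D : E × E →L[ℝ] E}
    (hW : HasStrictFDerivAt W D 0) :
    HasStrictFDerivAt (fun b => W (0, b)) (D.comp (ContinuousLinearMap.inr ℝ E E)) 0 :=
  HasStrictFDerivAt.comp (0 : E) (f := fun b : E => ((0 : E), b)) (g := W) hW
    (ContinuousLinearMap.inr ℝ E E).hasStrictFDerivAt

lemma HasStrictFDerivAt.apply_fst_of_eventually {W : E × E → E} {D : E × E →L[ℝ] E}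
    (hW : HasStrictFDerivAt W D 0) {A : E →L[ℝ] E} (h : ∀ᶠ a in 𝓝 0, W (a, 0) = A a) (a : E) :
    D (a, 0) = A a := by
  have h1 := (hW.comp_inl_zero.hasFDerivAt.congr_of_eventuallyEq
    (Filter.EventuallyEq.symm h)).unique A.hasFDerivAt
  exact DFunLike.congr_fun h1 a

lemma HasStrictFDerivAt.apply_snd_of_eventually {W : E × E → E} {D : E × E →L[ℝ] E}
    (hW : HasStrictFDerivAt W D 0) {A : E →L[ℝ] E} (h : ∀ᶠ b in 𝓝 0, W (0, b) = A b) (b : E) :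
    D (0, b) = A b := by
  have h1 := (hW.comp_inr_zero.hasFDerivAt.congr_of_eventuallyEq
    (Filter.EventuallyEq.symm h)).unique A.hasFDerivAt
  exact DFunLike.congr_fun h1 b

lemma HasStrictFDerivAt.apply_diag_of_eventually {W : E × E → E} {D : E × E →L[ℝ] E}
    (hW : HasStrictFDerivAt W D 0) {A : E →L[ℝ] E} (h : ∀ᶠ a in 𝓝 0, W (a, a) = A a) (a : E) :
    D (a, a) = A a := by
  have h0 : HasStrictFDerivAt (fun a => W (a, a))
      (D.comp ((ContinuousLinearMap.id ℝ E).prod (ContinuousLinearMap.id ℝ E))) 0 :=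
    HasStrictFDerivAt.comp (0 : E) (f := fun a : E => (a, a)) (g := W) hW
      ((ContinuousLinearMap.id ℝ E).prod (ContinuousLinearMap.id ℝ E)).hasStrictFDerivAt
  have h1 := (h0.hasFDerivAt.congr_of_eventuallyEq
    (Filter.EventuallyEq.symm h)).unique A.hasFDerivAt
  exact DFunLike.congr_fun h1 a

end Derivatives

/-! ### Derivatives of the group operations and the linearising chart. -/

section Group

variable {E : Type*} [NormedAddCommGroup E] [NormedSpace ℝ E]
  {L : Type*} [TopologicalSpace L] [Group L] {χ : OpenPartialHomeomorph L E} (hχ : χ.IsCentred)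
include hχ

lemma OpenPartialHomeomorph.IsCentred.apply_mul {D : E × E →L[ℝ] E}
    (hD : HasStrictFDerivAt (fun p : E × E => χ (χ.symm p.1 * χ.symm p.2)) D 0) (a b : E) :
    D (a, b) = a + b := by
  have h1 : D (a, 0) = a := by
    refine hD.apply_fst_of_eventually (A := ContinuousLinearMap.id ℝ E) ?_ a
    filter_upwards [hχ.eventually_mem_target] with a ha
    simp [hχ.symm_zero, χ.right_inv ha]
  have h2 : D (0, b) = b := by
    refine hD.apply_snd_of_eventually (A := ContinuousLinearMap.id ℝ E) ?_ b
    filter_upwards [hχ.eventually_mem_target] with a ha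
    simp [hχ.symm_zero, χ.right_inv ha]
  calc D (a, b) = D ((a, 0) + (0, b)) := by simp
    _ = _ := by rw [map_add, h1, h2]

/-- The diagonal, where `x⁻¹ * x = 1`, and the second axis determine `D`, so the derivative of
inversion need not be known beforehand; it is a corollary. -/
lemma OpenPartialHomeomorph.IsCentred.apply_inv_mul {D : E × E →L[ℝ] E}
    (hD : HasStrictFDerivAt (fun p : E × E => χ ((χ.symm p.1)⁻¹ * χ.symm p.2)) D 0) (a b : E) :
    D (a, b) = b - a := by
  have h1 : D (a, a) = 0 := by
    refine hD.apply_diag_of_eventually (A := 0) (Filter.Eventually.of_forall fun a => ?_) a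
    simp [hχ.map_one]
  have h2 : ∀ b, D (0, b) = b := by
    refine hD.apply_snd_of_eventually (A := ContinuousLinearMap.id ℝ E) ?_
    filter_upwards [hχ.eventually_mem_target] with a ha
    simp [hχ.symm_zero, χ.right_inv ha]
  calc D (a, b) = D ((a, a) + (0, b - a)) := by simp
    _ = _ := by rw [map_add, h1, h2, zero_add]

lemma OpenPartialHomeomorph.IsCentred.apply_conj {D : E × E →L[ℝ] E}
    (hD : HasStrictFDerivAt
      (fun p : E × E => χ ((χ.symm p.1)⁻¹ * χ.symm p.2 * χ.symm p.1)) D 0) (a b : E) :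
    D (a, b) = b := by
  have h1 : D (a, 0) = 0 := by
    refine hD.apply_fst_of_eventually (A := 0) (Filter.Eventually.of_forall fun a => ?_) a
    simp [hχ.map_one, hχ.symm_zero]
  have h2 : D (0, b) = b := by
    refine hD.apply_snd_of_eventually (A := ContinuousLinearMap.id ℝ E) ?_ b
    filter_upwards [hχ.eventually_mem_target] with a ha
    simp [hχ.symm_zero, χ.right_inv ha]
  calc D (a, b) = D ((a, 0) + (0, b)) := by simp
    _ = _ := by rw [map_add, h1, h2, zero_add]

lemma OpenPartialHomeomorph.IsCentred.hasStrictFDerivAt_inv {D : E × E →L[ℝ] E}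
    (hD : HasStrictFDerivAt (fun p : E × E => χ ((χ.symm p.1)⁻¹ * χ.symm p.2)) D 0) :
    HasStrictFDerivAt (fun a => χ ((χ.symm a)⁻¹)) (-ContinuousLinearMap.id ℝ E) 0 := by
  have := hD.comp_inl_zero
  simp only [hχ.symm_zero, mul_one] at this
  convert this using 1
  ext a
  simp [hχ.apply_inv_mul hD]

lemma OpenPartialHomeomorph.IsCentred.hasStrictFDerivAt_pow [ContinuousMul L] {D : E × E →L[ℝ] E}
    (hD : HasStrictFDerivAt (fun p : E × E => χ (χ.symm p.1 * χ.symm p.2)) D 0) (n : ℕ) :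
    HasStrictFDerivAt (fun a => χ ((χ.symm a) ^ n)) ((n : ℝ) • ContinuousLinearMap.id ℝ E) 0 := by
  induction n with
  | zero => simpa [hχ.map_one] using hasStrictFDerivAt_const (0 : E) (0 : E)
  | succ n ih =>
    have h1 : HasStrictFDerivAt (fun a => χ (χ.symm (χ ((χ.symm a) ^ n)) * χ.symm a))
        (D.comp (((n : ℝ) • ContinuousLinearMap.id ℝ E).prod (ContinuousLinearMap.id ℝ E))) 0 := by
      refine HasStrictFDerivAt.comp (0 : E) (f := fun a : E => (χ ((χ.symm a) ^ n), a))
        (g := fun p : E × E => χ (χ.symm p.1 * χ.symm p.2)) ?_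
        (ih.prodMk (hasStrictFDerivAt_id (0 : E)))
      simp only [hχ.symm_zero, one_pow, hχ.map_one]
      exact hD
    have hp : Filter.Tendsto (fun x : L => x ^ n) (𝓝 1) (𝓝 1) :=
      (continuous_pow n).tendsto' 1 1 (one_pow n)
    refine (h1.congr_of_eventuallyEq ?_).congr_fderiv ?_
    · filter_upwards [(hp.comp hχ.tendsto_symm).eventually hχ.eventually_mem_source] with a ha
      dsimp only [Function.comp_apply] at ha
      rw [χ.left_inv ha, pow_succ]
    · ext a
      simp [hχ.apply_mul hD, add_smul]

/-- A centred chart can be replaced by a tangent one in which inversion is `-1` and the power map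
`x ↦ x ^ m` is multiplication by `m`. -/
theorem OpenPartialHomeomorph.IsCentred.exists_isTangent_map_pow [IsTopologicalGroup L]
    [CompleteSpace E] {D₁ D₂ : E × E →L[ℝ] E}
    (hmul : HasStrictFDerivAt (fun p : E × E => χ (χ.symm p.1 * χ.symm p.2)) D₁ 0)
    (hdiv : HasStrictFDerivAt (fun p : E × E => χ ((χ.symm p.1)⁻¹ * χ.symm p.2)) D₂ 0)
    {m : ℕ} (hm : 1 < m) (hpow : ContDiffAt ℝ 2 (fun a => χ ((χ.symm a) ^ m)) 0) :
    ∃ η : OpenPartialHomeomorph L E, η.IsCentred ∧ χ.IsTangent η ∧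
      (∀ᶠ x in 𝓝 1, η x⁻¹ = -η x) ∧ ∀ᶠ x in 𝓝 1, η (x ^ m) = (m : ℝ) • η x := by
  have hm0 : (0 : ℝ) < m := by exact_mod_cast zero_lt_one.trans hm
  let P : E → E := fun a => χ ((χ.symm a) ^ m)
  have hP0 : P 0 = 0 := by simp [P, hχ.symm_zero, hχ.map_one]
  let M : E ≃L[ℝ] E := ContinuousLinearEquiv.smulLeft (Units.mk0 (m : ℝ) hm0.ne')
  have hPM : HasStrictFDerivAt P (M : E →L[ℝ] E) 0 := hχ.hasStrictFDerivAt_pow hmul m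
  -- The power map expands, so the linearisation theorem is applied to its local inverse.
  let T : E → E := hPM.localInverse P M 0
  have hTP : ∀ᶠ a in 𝓝 0, T (P a) = a := hPM.eventually_left_inverse
  have hT0 : T 0 = 0 := by simpa [hP0] using hTP.self_of_nhds
  have hT : HasFDerivAt T ((m : ℝ)⁻¹ • ContinuousLinearMap.id ℝ E) 0 := by
    have := hPM.to_localInverse.hasFDerivAt
    rw [hP0] at this
    exact this
  have hT2 : ContDiffAt ℝ 2 T 0 := by
    have := hpow.to_localInverse (f' := M) hPM.hasFDerivAt (by norm_num)
    rw [show χ (χ.symm 0 ^ m) = 0 from hP0] at this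
    exact this
  obtain ⟨ψ, hψ0, hψ, hψT⟩ := hT2.exists_koenigs_linearization (inv_pos.2 hm0)
    (inv_lt_one_of_one_lt₀ (by exact_mod_cast hm)) hT0 hT
  have htpow : Filter.Tendsto (fun x : L => x ^ m) (𝓝 1) (𝓝 1) :=
    (continuous_pow m).tendsto' 1 1 (one_pow m)
  have htinv : Filter.Tendsto (fun x : L => x⁻¹) (𝓝 1) (𝓝 1) :=
    continuous_inv.tendsto' 1 1 inv_one
  have hψpow : ∀ᶠ x in 𝓝 1, ψ (χ (x ^ m)) = (m : ℝ) • ψ (χ x) := by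
    filter_upwards [(hχ.tendsto.comp htpow).eventually hψT, hχ.tendsto.eventually hTP,
      hχ.eventually_mem_source] with x h1 h2 h3
    simp only [P, χ.left_inv h3, Function.comp_apply] at h1 h2
    rw [h2] at h1
    rw [h1, smul_smul, mul_inv_cancel₀ hm0.ne', one_smul]
  have hJ := hχ.hasStrictFDerivAt_inv hdiv
  -- The odd part of `ψ` under inversion. Inversion commutes with powers, so `l` still linearises
  -- the power map, and its derivative is `(id - (-id)) / 2 = id`.
  let l : E → E := fun a => (2⁻¹ : ℝ) • (ψ a - ψ (χ ((χ.symm a)⁻¹)))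
  have hl0 : l 0 = 0 := by simp [l, hχ.symm_zero, hχ.map_one]
  have hl' : HasStrictFDerivAt l (ContinuousLinearMap.id ℝ E) 0 := by
    have h1 : HasStrictFDerivAt (fun a => ψ (χ ((χ.symm a)⁻¹))) (-ContinuousLinearMap.id ℝ E) 0 := by
      have := HasStrictFDerivAt.comp (0 : E) (f := fun a => χ ((χ.symm a)⁻¹)) (g := ψ)
        (g' := ContinuousLinearMap.id ℝ E) (by simpa [hχ.symm_zero, hχ.map_one] using hψ) hJ
      rwa [ContinuousLinearMap.id_comp] at this
    refine ((hψ.sub h1).const_smul (2⁻¹ : ℝ)).congr_fderiv ?_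
    ext a
    rw [sub_neg_eq_add, ← two_smul ℝ, smul_smul]
    norm_num
  have hl : HasStrictFDerivAt l ((ContinuousLinearEquiv.refl ℝ E : E ≃L[ℝ] E) : E →L[ℝ] E) 0 := hl'
  let Λ : OpenPartialHomeomorph E E := hl.toOpenPartialHomeomorph l
  have hΛ : ∀ a, Λ a = l a := fun _ => rfl
  have hΛ0 : (0 : E) ∈ Λ.source := hl.mem_toOpenPartialHomeomorph_source
  have hΛ1 : (0 : E) ∈ Λ.target := by
    have := hl.image_mem_toOpenPartialHomeomorph_target
    rwa [hl0] at this
  have hη : ∀ x, (χ.trans Λ) x = l (χ x) := fun _ => rfl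
  have hηs : ∀ a, (χ.trans Λ).symm a = χ.symm (Λ.symm a) := fun _ => rfl
  have hlψ : ∀ᶠ x in 𝓝 1, l (χ x) = (2⁻¹ : ℝ) • (ψ (χ x) - ψ (χ x⁻¹)) := by
    filter_upwards [hχ.eventually_mem_source] with x hx
    simp only [l, χ.left_inv hx]
  refine ⟨χ.trans Λ, ⟨?_, ?_⟩, ⟨?_, ?_⟩, ?_, ?_⟩
  · rw [OpenPartialHomeomorph.trans_source]
    exact ⟨hχ.mem_source, by simpa [hχ.map_one] using hΛ0⟩
  · rw [hη, hχ.map_one, hl0]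
  · refine hl'.congr_of_eventuallyEq ?_
    filter_upwards [hχ.eventually_mem_target] with a ha
    rw [hη, χ.right_inv ha]
  · have h1 : HasStrictFDerivAt Λ.symm (ContinuousLinearMap.id ℝ E) 0 := by
      have := hl.to_localInverse
      rw [hl0] at this
      exact this
    refine h1.congr_of_eventuallyEq ?_
    have h2 : Filter.Tendsto Λ.symm (𝓝 0) (𝓝 0) := by
      have h3 : Λ.symm 0 = 0 := by
        have := Λ.left_inv hΛ0
        rwa [hΛ, hl0] at this
      simpa [ContinuousAt, h3] using Λ.symm.continuousAt (x := 0) hΛ1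
    filter_upwards [h2.eventually hχ.eventually_mem_target] with a ha
    rw [hηs, χ.right_inv ha]
  · filter_upwards [hlψ, htinv.eventually hlψ] with x h1 h2
    rw [hη, hη, h1, h2, inv_inv, ← smul_neg, neg_sub]
  · filter_upwards [hlψ, htpow.eventually hlψ, hψpow, htinv.eventually hψpow] with x h1 h2 h3 h4
    rw [inv_pow] at h4
    rw [hη, hη, h1, h2, h3, h4, ← smul_sub, smul_comm]

end Group

/-! ### Logarithm-like charts on Lie groups. -/

/-- A centred chart of a topological group in which inversion is `-1`, the power map `x ↦ x ^ m` is
multiplication by `m`, and the group operations satisfy first and second order estimates. -/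
structure OpenPartialHomeomorph.IsLogChart {E L : Type*} [NormedAddCommGroup E] [NormedSpace ℝ E]
    [TopologicalSpace L] [Group L] (χ : OpenPartialHomeomorph L E) (m : ℕ) (C : ℝ) : Prop
    extends χ.IsCentred where
  map_inv : ∀ᶠ x in 𝓝 1, χ x⁻¹ = -χ x
  map_pow : ∀ᶠ x in 𝓝 1, χ (x ^ m) = (m : ℝ) • χ x
  norm_mul : ∀ᶠ p : L × L in 𝓝 (1, 1), ‖χ (p.1 * p.2)‖ ≤ 2.02 * max ‖χ p.1‖ ‖χ p.2‖
  norm_inv_mul : ∀ᶠ p : L × L in 𝓝 (1, 1), ‖χ (p.1⁻¹ * p.2)‖ ≤ 2 * ‖χ p.2 - χ p.1‖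
  norm_conj : ∀ᶠ p : L × L in 𝓝 (1, 1), ‖χ (p.1⁻¹ * p.2 * p.1)‖ ≤ 2 * ‖χ p.2‖
  norm_commutator : ∀ᶠ p : L × L in 𝓝 (1, 1),
    ‖χ (p.1⁻¹ * p.2⁻¹ * p.1 * p.2)‖ ≤ C * ‖χ p.1‖ * ‖χ p.2‖
  sq_inj : ∀ᶠ p : L × L in 𝓝 (1, 1), p.1 ^ 2 = p.2 ^ 2 → p.1 = p.2

/-- Charts of the above kind exist around the identity of every Lie group. -/
theorem LieGroup.exists_isLogChart
    {E : Type*} [NormedAddCommGroup E] [NormedSpace ℝ E] [CompleteSpace E]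
    {H : Type*} [TopologicalSpace H] (I : ModelWithCorners ℝ E H) [I.Boundaryless]
    (L : Type*) [TopologicalSpace L] [ChartedSpace H L] [Group L] [LieGroup I ∞ L]
    {m : ℕ} (hm : 1 < m) :
    ∃ (χ : OpenPartialHomeomorph L E) (C : ℝ), 0 < C ∧ χ.IsLogChart m C := by
  have : IsTopologicalGroup L := topologicalGroup_of_lieGroup I ∞
  obtain ⟨φ, hφ, hφ1, hφ2⟩ := exists_centred_smooth_chart (I := I) (L := L)
  have smul : ContMDiff (I.prod I) I ∞ fun p : L × L => p.1 * p.2 :=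
    contMDiff_fst.mul contMDiff_snd
  have sdiv : ContMDiff (I.prod I) I ∞ fun p : L × L => p.1⁻¹ * p.2 :=
    contMDiff_fst.inv.mul contMDiff_snd
  have sconj : ContMDiff (I.prod I) I ∞ fun p : L × L => p.1⁻¹ * p.2 * p.1 :=
    sdiv.mul contMDiff_fst
  have scomm : ContMDiff (I.prod I) I ∞ fun p : L × L => p.1⁻¹ * p.2⁻¹ * p.1 * p.2 :=
    ((contMDiff_fst.inv.mul contMDiff_snd.inv).mul contMDiff_fst).mul contMDiff_snd
  have spow : ContMDiff I I ∞ fun x : L => x ^ m := contMDiff_pow m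
  have h2 : (2 : ℕ∞ω) ≤ ∞ := ENat.LEInfty.out
  have h1 : (∞ : ℕ∞ω) ≠ 0 := by simp
  have dmul := (smul.contDiffAt_centred_prod hφ hφ1 hφ2 (by simp)).hasStrictFDerivAt h1
  have ddiv := (sdiv.contDiffAt_centred_prod hφ hφ1 hφ2 (by simp)).hasStrictFDerivAt h1
  have dconj := (sconj.contDiffAt_centred_prod hφ hφ1 hφ2 (by simp)).hasStrictFDerivAt h1
  have ccomm := (scomm.contDiffAt_centred_prod hφ hφ1 hφ2 (by simp)).of_le h2
  have cpow := (spow.contDiffAt_centred hφ hφ1 hφ2 (one_pow m)).of_le h2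
  obtain ⟨χ, hχ, hT, hinv, hpow⟩ := hφ.exists_isTangent_map_pow dmul ddiv hm cpow
  obtain ⟨C, hC, hcomm⟩ := ccomm.exists_norm_le_mul_norm_of_axes
    (Filter.Eventually.of_forall fun a => by simp [hφ.symm_zero, hφ.map_one])
    (Filter.Eventually.of_forall fun a => by simp [hφ.symm_zero, hφ.map_one])
  have emul := hT.hasStrictFDerivAt hφ hχ (G := fun p => p.1 * p.2)
    smul.continuous.continuousAt (by simp) dmul
  have ediv := hT.hasStrictFDerivAt hφ hχ (G := fun p => p.1⁻¹ * p.2)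
    sdiv.continuous.continuousAt (by simp) ddiv
  have econj := hT.hasStrictFDerivAt hφ hχ (G := fun p => p.1⁻¹ * p.2 * p.1)
    sconj.continuous.continuousAt (by simp) dconj
  refine ⟨χ, 2 * C * 2 * 2, by positivity, hχ, hinv, hpow, ?_, ?_, ?_, ?_, ?_⟩
  -- Comparison with `(1, 1)`: the linear part contributes 2 and the error 0.02. The total must stay
  -- below the fourth root of 17, about 2.03.
  · have ht : Filter.Tendsto (fun p : L × L => (p, ((1 : L), (1 : L)))) (𝓝 (1, 1))
        (𝓝 ((1, 1), (1, 1))) := Continuous.tendsto' (by fun_prop) _ _ rfl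
    filter_upwards [ht.eventually (hχ.eventually_norm_sub_le (G := fun p => p.1 * p.2) emul
      (ε := 0.02) (by norm_num))]
      with p hp
    simp only [mul_one, hχ.map_one, sub_zero, hχ.apply_mul emul] at hp
    have h3 := norm_le_norm_add_norm_sub' (χ (p.1 * p.2)) (χ p.1 + χ p.2)
    have h4 := norm_add_le (χ p.1) (χ p.2)
    have h5 := le_max_left ‖χ p.1‖ ‖χ p.2‖
    have h6 := le_max_right ‖χ p.1‖ ‖χ p.2‖
    linarith
  -- Comparing with `(p.1, p.1)`, where the operation gives 1, leaves an error proportional to `‖χ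
  -- p.2 - χ p.1‖` alone. For conjugation the comparison point is `(p.1, 1)`.
  · have ht : Filter.Tendsto (fun p : L × L => (p, (p.1, p.1))) (𝓝 (1, 1))
        (𝓝 ((1, 1), (1, 1))) := Continuous.tendsto' (by fun_prop) _ _ rfl
    filter_upwards [ht.eventually (hχ.eventually_norm_sub_le (G := fun p => p.1⁻¹ * p.2) ediv
      (ε := 1) (by norm_num))] with p hp
    simp only [inv_mul_cancel, hχ.map_one, sub_zero, hχ.apply_inv_mul ediv, sub_self, norm_zero,
      one_mul, max_eq_right (norm_nonneg _)] at hp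
    linarith [norm_le_norm_add_norm_sub' (χ (p.1⁻¹ * p.2)) (χ p.2 - χ p.1)]
  · have ht : Filter.Tendsto (fun p : L × L => (p, (p.1, (1 : L)))) (𝓝 (1, 1))
        (𝓝 ((1, 1), (1, 1))) := Continuous.tendsto' (by fun_prop) _ _ rfl
    filter_upwards [ht.eventually (hχ.eventually_norm_sub_le (G := fun p => p.1⁻¹ * p.2 * p.1) econj
      (ε := 1) (by norm_num))]
      with p hp
    simp only [mul_one, inv_mul_cancel, hχ.map_one, sub_zero, hχ.apply_conj econj, sub_self,
      norm_zero, one_mul, max_eq_right (norm_nonneg _)] at hp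
    linarith [norm_le_norm_add_norm_sub' (χ (p.1⁻¹ * p.2 * p.1)) (χ p.2)]
  -- The commutator estimate needs `C²`, so it is taken from `φ`; tangency makes the norms of `φ`
  -- and `χ` comparable within a factor 2.
  · have hb : ∀ f : E → E, f 0 = 0 → HasStrictFDerivAt f (ContinuousLinearMap.id ℝ E) 0 →
        ∀ᶠ a in 𝓝 0, ‖f a‖ ≤ 2 * ‖a‖ := by
      intro f hf0 hf
      filter_upwards [Asymptotics.isLittleO_iff.1 hf.hasFDerivAt.isLittleO one_pos] with a ha
      rw [hf0, sub_zero, sub_zero, one_mul, ContinuousLinearMap.id_apply] at ha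
      linarith [norm_le_norm_add_norm_sub' (f a) a]
    have b1 : ∀ᶠ x in 𝓝 1, ‖χ x‖ ≤ 2 * ‖φ x‖ := by
      filter_upwards [hφ.tendsto.eventually (hb _ (by rw [hφ.symm_zero, hχ.map_one]) hT.transition),
        hφ.eventually_mem_source] with x hx hs
      rwa [φ.left_inv hs] at hx
    have b2 : ∀ᶠ x in 𝓝 1, ‖φ x‖ ≤ 2 * ‖χ x‖ := by
      filter_upwards [hχ.tendsto.eventually
        (hb _ (by rw [hχ.symm_zero, hφ.map_one]) hT.transition_symm),
        hχ.eventually_mem_source] with x hx hs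
      rwa [χ.left_inv hs] at hx
    have t1 : Filter.Tendsto (fun p : L × L => p.1) (𝓝 (1, 1)) (𝓝 1) :=
      continuous_fst.tendsto' _ _ rfl
    have t2 : Filter.Tendsto (fun p : L × L => p.2) (𝓝 (1, 1)) (𝓝 1) :=
      continuous_snd.tendsto' _ _ rfl
    have t3 : Filter.Tendsto (fun p : L × L => p.1⁻¹ * p.2⁻¹ * p.1 * p.2) (𝓝 (1, 1)) (𝓝 1) :=
      Continuous.tendsto' (by fun_prop) _ _ (by simp)
    have t4 : Filter.Tendsto (fun p : L × L => (φ p.1, φ p.2)) (𝓝 (1, 1)) (𝓝 0) :=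
      (hφ.tendsto.comp t1).prodMk_nhds (hφ.tendsto.comp t2)
    filter_upwards [t3.eventually b1, t1.eventually b2, t2.eventually b2, t4.eventually hcomm,
      t1.eventually hφ.eventually_mem_source, t2.eventually hφ.eventually_mem_source]
      with p h3 h4 h5 h6 h7 h8
    simp only [φ.left_inv h7, φ.left_inv h8] at h6
    calc _ ≤ 2 * (C * ‖φ p.1‖ * ‖φ p.2‖) := h3.trans (by gcongr)
      _ ≤ 2 * (C * (2 * ‖χ p.1‖) * (2 * ‖χ p.2‖)) := by gcongr
      _ = _ := by ring
  -- Squaring has derivative `2 • id`, so equal squares give `2 * ‖χ p.1 - χ p.2‖ ≤ ‖χ p.1 - χ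
  -- p.2‖`.
  · have ht : Filter.Tendsto (fun p : L × L => ((p.1, p.1), (p.2, p.2))) (𝓝 (1, 1))
        (𝓝 ((1, 1), (1, 1))) := Continuous.tendsto' (by fun_prop) _ _ rfl
    filter_upwards [ht.eventually (hχ.eventually_norm_sub_le (G := fun p => p.1 * p.2) emul
      (ε := 1) (by norm_num)),
      (continuous_fst.tendsto' ((1, 1) : L × L) 1 rfl).eventually hχ.eventually_mem_source,
      (continuous_snd.tendsto' ((1, 1) : L × L) 1 rfl).eventually hχ.eventually_mem_source]
      with p hp hs1 hs2 hsq
    simp only [← pow_two, hsq, sub_self, zero_sub, norm_neg, hχ.apply_mul emul, max_self,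
      one_mul, ← two_smul ℝ, norm_smul] at hp
    rw [Real.norm_of_nonneg (by norm_num)] at hp
    have h3 : ‖χ p.1 - χ p.2‖ = 0 := le_antisymm (by linarith) (norm_nonneg _)
    exact χ.injOn hs1 hs2 (sub_eq_zero.1 (norm_eq_zero.1 h3))

/-! ### The neighbourhoods as balls in the chart. -/

theorem lemmal
    {E : Type*} [NormedAddCommGroup E] [NormedSpace ℝ E] [FiniteDimensional ℝ E]
    {H : Type*} [TopologicalSpace H] (I : ModelWithCorners ℝ E H) [I.Boundaryless]
    (L : Type*) [TopologicalSpace L] [ChartedSpace H L] [Group L] [LieGroup I ∞ L]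
    (U : Set L) (hU : IsCompact U) (hU1 : U ∈ 𝓝 (1 : L)) :
    ∃ V : ℕ → Set L,
      -- symmetric compact neighbourhoods of the identity, each inside the interior of the previous
      (∀ n, IsCompact (V n) ∧ V n ∈ 𝓝 (1 : L) ∧ (1 : L) ∈ V n ∧ (V n)⁻¹ = V n) ∧
      (∀ n, V (n + 1) ⊆ interior (V n)) ∧
      V 0 ⊆ interior U ∧
      -- (1) covering by left translates
      (∀ n, ∃ Z : Finset L, Z.card ≤ 17 ^ Module.finrank ℝ E ∧
        V n ⊆ ⋃ z ∈ Z, z • V (n + 1)) ∧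
      -- (2)
      (∀ n, V (n + 1) * V (n + 1) ⊆ V n) ∧
      -- (3)
      (∀ n, ∀ x ∈ V 0, ∀ y ∈ V (n + 1), x⁻¹ * y * x ∈ V n) ∧
      -- (4) with the commutator convention [x, y] = x⁻¹ y⁻¹ x y
      (∀ n n₁ n₂ : ℕ, n ≤ n₁ + n₂ →
        ∀ x ∈ V n₁, ∀ y ∈ V n₂, x⁻¹ * y⁻¹ * x * y ∈ V n) ∧
      -- (5)
      (∀ x ∈ V 0, ∀ y ∈ V 0, x ^ 2 = y ^ 2 → x = y) ∧
      -- (6)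
      (∀ n, V (n + 4) = {x | x ∈ V 0 ∧ x ^ 17 ∈ V n}) := by
  have : IsTopologicalGroup L := topologicalGroup_of_lieGroup I ∞
  have : CompleteSpace E := FiniteDimensional.complete ℝ E
  obtain ⟨χ, C, hC, hχ⟩ := LieGroup.exists_isLogChart I L (m := 17) (by norm_num)
  have hχc := hχ.toIsCentred
  -- the words occurring below stay in the chart
  have t1 : Filter.Tendsto (fun p : L × L => p.1) (𝓝 (1, 1)) (𝓝 1) :=
    continuous_fst.tendsto' _ _ rfl
  have hs : ∀ g : L × L → L, Continuous g → g (1, 1) = 1 →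
      ∀ᶠ p : L × L in 𝓝 (1, 1), g p ∈ χ.source := fun g hg h1 =>
    (hg.tendsto' (1, 1) 1 h1).eventually hχc.eventually_mem_source
  have hev : ∀ᶠ p : L × L in 𝓝 (1, 1),
      p.1 ∈ interior U ∧ (χ p.1⁻¹ = -χ p.1 ∧ p.1⁻¹ ∈ χ.source) ∧
      (χ (p.1 ^ 17) = (17 : ℝ) • χ p.1 ∧ p.1 ^ 17 ∈ χ.source) ∧
      (‖χ (p.1 * p.2)‖ ≤ 2.02 * max ‖χ p.1‖ ‖χ p.2‖ ∧ p.1 * p.2 ∈ χ.source) ∧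
      (‖χ (p.1⁻¹ * p.2)‖ ≤ 2 * ‖χ p.2 - χ p.1‖ ∧ p.1⁻¹ * p.2 ∈ χ.source) ∧
      (‖χ (p.1⁻¹ * p.2 * p.1)‖ ≤ 2 * ‖χ p.2‖ ∧ p.1⁻¹ * p.2 * p.1 ∈ χ.source) ∧
      (‖χ (p.1⁻¹ * p.2⁻¹ * p.1 * p.2)‖ ≤ C * ‖χ p.1‖ * ‖χ p.2‖ ∧
        p.1⁻¹ * p.2⁻¹ * p.1 * p.2 ∈ χ.source) ∧ (p.1 ^ 2 = p.2 ^ 2 → p.1 = p.2) := by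
    refine (t1.eventually (interior_mem_nhds.2 hU1)).and <|
      ((t1.eventually hχ.map_inv).and (hs (fun p => p.1⁻¹) (by fun_prop) (by simp))).and <|
      ((t1.eventually (by simpa using hχ.map_pow)).and
        (hs (fun p => p.1 ^ 17) (by fun_prop) (by simp))).and <|
      (hχ.norm_mul.and (hs (fun p => p.1 * p.2) (by fun_prop) (by simp))).and <|
      (hχ.norm_inv_mul.and (hs (fun p => p.1⁻¹ * p.2) (by fun_prop) (by simp))).and <|
      (hχ.norm_conj.and (hs (fun p => p.1⁻¹ * p.2 * p.1) (by fun_prop) (by simp))).and <|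
      (hχ.norm_commutator.and
        (hs (fun p => p.1⁻¹ * p.2⁻¹ * p.1 * p.2) (by fun_prop) (by simp))).and hχ.sq_inj
  have hT : Filter.Tendsto (fun p : E × E => (χ.symm p.1, χ.symm p.2)) (𝓝 0) (𝓝 (1, 1)) :=
    (hχc.tendsto_symm.comp (continuous_fst.tendsto' (0 : E × E) 0 rfl)).prodMk_nhds
      (hχc.tendsto_symm.comp (continuous_snd.tendsto' (0 : E × E) 0 rfl))
  obtain ⟨δ, hδ, hb⟩ := Metric.nhds_basis_closedBall.eventually_iff.1 ((hT.eventually hev).and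
    ((continuous_fst.tendsto' (0 : E × E) 0 rfl).eventually hχc.eventually_mem_target))
  obtain ⟨r, hr, hrδ, hrC⟩ : ∃ r > 0, r ≤ δ ∧ C * r ≤ 1 :=
    ⟨min δ C⁻¹, lt_min hδ (inv_pos.2 hC), min_le_left _ _, by
      calc C * min δ C⁻¹ ≤ C * C⁻¹ := by gcongr; exact min_le_right _ _
        _ = 1 := mul_inv_cancel₀ hC.ne'⟩
  -- Four steps must shrink the radius by exactly 17, as (6) demands. The bound `2.02 ≤ q` serves
  -- (2) and (3), and `q ≤ 4` serves (1).
  obtain ⟨q, hq0, hq4⟩ : ∃ q : ℝ, 0 < q ∧ q ^ 4 = 17 := by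
    refine ⟨√√17, by positivity, ?_⟩
    rw [show (4 : ℕ) = 2 * 2 from rfl, pow_mul, Real.sq_sqrt (by positivity),
      Real.sq_sqrt (by norm_num)]
  have hq1 : 2.02 ≤ q := le_of_pow_le_pow_left₀ (n := 4) (by norm_num) hq0.le (by norm_num [hq4])
  have hq2 : q ≤ 4 := le_of_pow_le_pow_left₀ (n := 4) (by norm_num) (by norm_num) (by norm_num [hq4])
  let ρ : ℕ → ℝ := fun n => r / q ^ n
  have hρ0 : ∀ n, 0 < ρ n := fun n => by positivity
  have hρs : ∀ n, ρ n = q * ρ (n + 1) := fun n => by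
    simp only [ρ, pow_succ]; field_simp
  have hρ4 : ∀ n, ρ n = 17 * ρ (n + 4) := fun n => by
    simp only [ρ, pow_add, hq4]; field_simp
  have hρanti : ∀ m n, m ≤ n → ρ n ≤ ρ m := fun m n hmn => by
    simp only [ρ]
    gcongr
    linarith
  have hρr : ∀ n, ρ n ≤ r := fun n => by simpa [ρ] using hρanti 0 n (Nat.zero_le n)
  have htarget : ∀ a : E, ‖a‖ ≤ r → a ∈ χ.target := fun a ha =>
    (hb (x := (a, 0)) (by simpa [Prod.norm_def, hδ.le] using ha.trans hrδ)).2
  let V : ℕ → Set L := fun n => χ.symm '' Metric.closedBall 0 (ρ n)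
  have hV : ∀ n x, x ∈ V n ↔ x ∈ χ.source ∧ ‖χ x‖ ≤ ρ n := by
    intro n x
    constructor
    · rintro ⟨a, ha, rfl⟩
      have ha' : ‖a‖ ≤ ρ n := by simpa using ha
      have hat := htarget a (ha'.trans (hρr n))
      exact ⟨χ.map_target hat, by rwa [χ.right_inv hat]⟩
    · rintro ⟨hx, hn⟩
      exact ⟨χ x, by simpa using hn, χ.left_inv hx⟩
  have hVanti : ∀ m n, m ≤ n → V n ⊆ V m := fun m n hmn =>
    Set.image_mono (Metric.closedBall_subset_closedBall (hρanti m n hmn))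
  have hP : ∀ x ∈ V 0, ∀ y ∈ V 0, _ := fun x hx y hy => by
    obtain ⟨hxs, hxn⟩ := (hV 0 x).1 hx
    obtain ⟨hys, hyn⟩ := (hV 0 y).1 hy
    have := (hb (x := (χ x, χ y)) (by
      simpa [Prod.norm_def] using ⟨hxn.trans ((hρr 0).trans hrδ), hyn.trans ((hρr 0).trans hrδ)⟩)).1
    simp only [χ.left_inv hxs, χ.left_inv hys] at this
    exact this
  have hopen : ∀ n, {x | x ∈ χ.source ∧ ‖χ x‖ < ρ n} ⊆ interior (V n) := by
    intro n
    refine interior_maximal (fun x hx => (hV n x).2 ⟨hx.1, hx.2.le⟩) ?_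
    convert χ.isOpen_inter_preimage (Metric.isOpen_ball (x := (0 : E)) (ε := ρ n)) using 1
    ext x
    simp
  have h1V : ∀ n, (1 : L) ∈ interior (V n) := fun n =>
    hopen n ⟨hχc.mem_source, by rw [hχc.map_one, norm_zero]; exact hρ0 n⟩
  have hinv : ∀ n, ∀ x ∈ V n, x⁻¹ ∈ V n := by
    intro n x hx
    have hx0 := hVanti 0 n (Nat.zero_le n) hx
    obtain ⟨-, ⟨e, hs⟩, -⟩ := hP x hx0 x hx0
    exact (hV n _).2 ⟨hs, by rw [e, norm_neg]; exact ((hV n x).1 hx).2⟩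
  refine ⟨V, fun n => ⟨?_, mem_interior_iff_mem_nhds.1 (h1V n), interior_subset (h1V n), ?_⟩,
    fun n => ?_, fun x hx => (hP x hx x hx).1, fun n => ?_, fun n => ?_, fun n x hx y hy => ?_,
    fun n n₁ n₂ hn x hx y hy => ?_, fun x hx y hy => ?_, fun n => ?_⟩
  · refine (isCompact_closedBall (0 : E) (ρ n)).image_of_continuousOn
      (χ.continuousOn_symm.mono fun a ha => htarget a ?_)
    exact (by simpa using ha : ‖a‖ ≤ ρ n).trans (hρr n)
  · ext x
    exact ⟨fun hx => by simpa using hinv n _ hx, fun hx => hinv n x hx⟩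
  · intro x hx
    obtain ⟨hxs, hxn⟩ := (hV _ x).1 hx
    refine hopen n ⟨hxs, hxn.trans_lt ?_⟩
    rw [hρs n]
    nlinarith [hρ0 (n + 1)]
  · classical
    obtain ⟨s, hcard, hsn, hcov⟩ := exists_finset_card_le_cover_closedBall E (hρ0 n)
    refine ⟨s.image χ.symm, Finset.card_image_le.trans hcard, fun x hx => ?_⟩
    obtain ⟨hxs, hxn⟩ := (hV n x).1 hx
    obtain ⟨z, hz, hzx⟩ := hcov (χ x) hxn
    have hzt := htarget z ((hsn z hz).trans (hρr n))
    have hzV : χ.symm z ∈ V n := ⟨z, by simpa using hsn z hz, rfl⟩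
    have h0 : 0 ≤ n := Nat.zero_le n
    obtain ⟨-, -, -, -, ⟨h1, h2⟩, -⟩ := hP _ (hVanti 0 n h0 hzV) x (hVanti 0 n h0 hx)
    rw [χ.right_inv hzt] at h1
    refine Set.mem_iUnion₂.2 ⟨χ.symm z, Finset.mem_image_of_mem _ hz, ?_⟩
    rw [Set.mem_smul_set_iff_inv_smul_mem, smul_eq_mul]
    refine (hV _ _).2 ⟨h2, h1.trans ?_⟩
    -- Left division at most doubles the distance `ρ n / 8`, and `ρ n / 4 ≤ ρ (n + 1)` because `q ≤
    -- 4`.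
    have := hρs n
    nlinarith [hρ0 (n + 1)]
  · rintro _ ⟨x, hx, y, hy, rfl⟩
    have h0 : 0 ≤ n + 1 := Nat.zero_le _
    obtain ⟨-, -, -, ⟨h1, h2⟩, -⟩ := hP x (hVanti 0 _ h0 hx) y (hVanti 0 _ h0 hy)
    refine (hV n _).2 ⟨h2, h1.trans ?_⟩
    have h3 : max ‖χ x‖ ‖χ y‖ ≤ ρ (n + 1) := max_le ((hV _ x).1 hx).2 ((hV _ y).1 hy).2
    rw [hρs n]
    gcongr
  · obtain ⟨-, -, -, -, -, ⟨h1, h2⟩, -⟩ := hP x hx y (hVanti 0 _ (Nat.zero_le _) hy)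
    refine (hV n _).2 ⟨h2, h1.trans ?_⟩
    rw [hρs n]
    gcongr
    · linarith
    · exact ((hV _ y).1 hy).2
  · obtain ⟨-, -, -, -, -, -, ⟨h1, h2⟩, -⟩ :=
      hP x (hVanti 0 _ (Nat.zero_le _) hx) y (hVanti 0 _ (Nat.zero_le _) hy)
    refine (hV n _).2 ⟨h2, h1.trans ?_⟩
    calc C * ‖χ x‖ * ‖χ y‖ ≤ C * ρ n₁ * ρ n₂ := by
          gcongr
          exacts [((hV _ x).1 hx).2, ((hV _ y).1 hy).2]
      -- Exponents of `q` add, and one spare factor `r` absorbs `C`.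
      _ = (C * r) * ρ (n₁ + n₂) := by simp only [ρ, pow_add]; field_simp
      _ ≤ 1 * ρ (n₁ + n₂) := by gcongr
      _ ≤ ρ n := by rw [one_mul]; exact hρanti _ _ hn
  · obtain ⟨-, -, -, -, -, -, -, h⟩ := hP x hx y hy
    exact h
  -- The chart turns the 17th power into exact scaling on `V 0`, so the criterion is an equivalence.
  · have key : ∀ x ∈ V 0, x ^ 17 ∈ V n ↔ ‖χ x‖ ≤ ρ (n + 4) := by
      intro x hx
      obtain ⟨-, -, ⟨h1, h2⟩, -⟩ := hP x hx x hx
      rw [hV, h1, norm_smul, Real.norm_of_nonneg (by norm_num), hρ4 n]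
      exact ⟨fun h => by linarith [h.2], fun h => ⟨h2, by linarith⟩⟩
    ext x
    refine ⟨fun hx => ?_, fun ⟨hx0, hx⟩ => (hV _ x).2 ⟨((hV 0 x).1 hx0).1, (key x hx0).1 hx⟩⟩
    have hx0 := hVanti 0 _ (Nat.zero_le _) hx
    exact ⟨hx0, (key x hx0).2 ((hV _ x).1 hx).2⟩
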